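/- **Setting.** For $d\ge 1$ let $\mathbb{N}^d$ carry the componentwise order and the norm $|x|=\max_i x_i$. Let $\mathbb{P}_f(\mathbb{N}^d)$ be the set of finite subsets of $\mathbb{N}^d$, with norm $|X|=\max(\{|x|:x\in X\}\cup\{\mathrm{card}(X)\})$ and with the two orderings $$X\sqsubseteq^{maj}Y\iff\forall x\in X\ \exists y\in Y:\ x\le y,\qquad X\sqsubseteq^{min}Y\iff\forall y\in Y\ \exists x\in X:\ x\le y .$$ For a quasi-order $(A,\le)$ with norm $|\cdot|:A\to\mathbb{N}$, a function $h:\mathbb{N}\to\mathbb{N}$ and $m\in\mathbb{N}$, a finite sequence $x_0,\dots,x_{l-1}$ in $A$ is *bad* if $x_i\not\le x_j$ for all $i<j$, and *$(h,m)$-controlled* if $|x_i|\le h^i(m)$ for all $i$, where $h^i$ is the $i$-fold iterate of $h$. $L_{A,h}(m)$ denotes the maximum length of an $(h,m)$-controlled bad sequence in $A$. For an ordinal $\alpha<\varepsilon_0$ written as $\alpha=\omega^{\beta_1}c_1+\dots+\omega^{\beta_m}c_m$ with $\beta_1>\dots>\beta_m$ and $c_i>0$, put $N\alpha=\max\{c_1,\dots,c_m,N\beta_1,\dots,N\beta_m\}$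 ($N0=0$). For limit ordinals fix the fundamental sequences $(\gamma+\omega^{\beta+1})(x)=\gamma+\omega^{\beta}\cdot(x+1)$ and $(\gamma+\omega^{\lambda})(x)=\gamma+\omega^{\lambda(x)}$ (for $\lambda$ a limit, the sums being in Cantor normal form), and let $P_x(\alpha+1)=\alpha$, $P_x(\lambda)=P_x(\lambda(x))$ for $\lambda$ a limit. The Cichon hierarchy of $g:\mathbb{N}\to\mathbb{N}$ is given by $g_0(x)=0$ and $g_\alpha(x)=1+g_{P_x(\alpha)}(g(x))$ for $0<\alpha<\varepsilon_0$. **Theorem.** Let $d\ge1$, let $g:\mathbb{N}\to\mathbb{N}$ be strictly increasing and inflationary ($g(x)\ge x$ for all $x$), let $\varphi(x)=x(x+1)^d$ and $p(x)=d(x+1)$, let $\alpha=\omega^{\omega^{d-1}}$ and let $n\ge N\alpha$. Then the two maximum lengths below exist and $$g_\alpha(n)\ \le\ L_{(\mathbb{P}_f(\mathbb{N}^d),\sqsubseteq^{maj}),\,\varphi\circ g}(\varphi(n))\ \le\ L_{(\mathbb{P}_f(\mathbb{N}^d),\sqsubseteq^{min}),\,p\circ\varphi\circ g}(p(\varphi(n))).$$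 -/

import Mathlib

/-! ### Ordinals below `ε₀`, their norm, predecessors, and the Cichon hierarchy

Ordinals below `ε₀` are Mathlib's Cantor normal forms `NONote` (the terms `ONote` satisfying the
predicate `ONote.NF`). The term `ONote.oadd e n a` stands for `ω ^ e * n + a`, with `0 < n`.
Mathlib's `ONote.fundamentalSequence` is the assignment
`(γ + ω ^ (β + 1))(x) = γ + ω ^ β * (x + 1)` and `(γ + ω ^ λ)(x) = γ + ω ^ λ(x)`. -/

/-- The norm `N`: the largest coefficient occurring anywhere in the (strict) Cantor normal form,
hereditarily in the exponents. -/
def ordNorm : ONote → ℕ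
  | ONote.zero => 0
  | ONote.oadd e n a => max (max (n : ℕ) (ordNorm e)) (ordNorm a)

/-- The predecessor `P_x`: `P_x (α + 1) = α` and `P_x λ = P_x (λ(x))` for limit `λ`.
(`P_x 0` is irrelevant and set to `0`.) -/
def ordPred (x : ℕ) (o : ONote) : ONote :=
  match o.fundamentalSequence, o.fundamentalSequence_has_prop with
  | Sum.inl none, _ => 0
  | Sum.inl (some a), _ => a
  | Sum.inr f, h =>
    have : f x < o := (h.2.1 x).2.1
    ordPred x (f x)
  termination_by o

theorem ordPred_lt (x : ℕ) (o : ONote) (ho : o ≠ 0) : ordPred x o < o := by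
  induction o using (InvImage.wf ONote.repr Ordinal.lt_wf).induction with
  | h o ih =>
    rw [ordPred]
    split
    · rename_i h _ _
      exact absurd h ho
    · rename_i a h _ _
      rw [ONote.lt_def, h.1]
      exact Order.lt_succ _
    · rename_i f h _ _
      have h1 : f x < o := (h.2.1 x).2.1
      by_cases h2 : f x = 0
      · have h3 : ordPred x 0 = 0 := by
          rw [ordPred]
          rfl
        show ordPred x (f x) < o
        rw [h2] at h1 ⊢
        rwa [h3]
      · exact (ih _ h1 h2).trans h1

/-- The Cichon hierarchy of `h`: `h_0(x) = 0` and `h_α(x) = 1 + h_{P_x(α)}(h(x))` for `α > 0`. -/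
def cichon (h : ℕ → ℕ) (o : ONote) (x : ℕ) : ℕ :=
  if ho : o = 0 then 0
  else
    have : ordPred x o < o := ordPred_lt x o ho
    1 + cichon h (ordPred x o) (h x)
  termination_by o

/-! ### Controlled bad sequences and length functions -/

/-- A finite sequence is bad if there are no `i < j` with `x i ≤ x j`. -/
def IsBadSeq {A : Type*} (le : A → A → Prop) {l : ℕ} (x : Fin l → A) : Prop :=
  ∀ i j : Fin l, i < j → ¬ le (x i) (x j)

/-- `x` is `(g, n)`-controlled: the norm of the `i`-th term is at most `g (g (... (g n)))`
(`i` times). -/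
def IsControlledSeq {A : Type*} (nrm : A → ℕ) (g : ℕ → ℕ) (n : ℕ) {l : ℕ} (x : Fin l → A) : Prop :=
  ∀ i : Fin l, nrm (x i) ≤ g^[(i : ℕ)] n

/-- The set of lengths of `(g, n)`-controlled bad sequences. -/
def badLengths {A : Type*} (le : A → A → Prop) (nrm : A → ℕ) (g : ℕ → ℕ) (n : ℕ) : Set ℕ :=
  {l | ∃ x : Fin l → A, IsBadSeq le x ∧ IsControlledSeq nrm g n x}

/-- The length function `L_{A,g}`: the maximum length of a `(g, n)`-controlled bad sequence. -/
noncomputable def lengthFn {A : Type*} (le : A → A → Prop) (nrm : A → ℕ) (g : ℕ → ℕ) (n : ℕ) : ℕ :=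
  sSup (badLengths le nrm g n)

/-! ### Finite powersets of `ℕ ^ d` -/

/-- The majoring ordering on finite subsets. -/
def MajLE {A : Type*} [LE A] (X Y : Finset A) : Prop := ∀ x ∈ X, ∃ y ∈ Y, x ≤ y

/-- The minoring ordering on finite subsets. -/
def MinLE {A : Type*} [LE A] (X Y : Finset A) : Prop := ∀ y ∈ Y, ∃ x ∈ X, x ≤ y

/-- The norm on finite subsets: the maximum of the norms of the elements and the cardinality. -/
def finsetNorm {A : Type*} (nrm : A → ℕ) (X : Finset A) : ℕ := max (X.sup nrm) X.card

/-- The norm on `ℕ ^ d`: the largest coordinate. -/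
def vecNorm {d : ℕ} (v : Fin d → ℕ) : ℕ := Finset.univ.sup v

/-- The length function of `(P_f(ℕ ^ d), maj)`. -/
noncomputable def lengthMaj (d : ℕ) (g : ℕ → ℕ) (n : ℕ) : ℕ :=
  lengthFn (A := Finset (Fin d → ℕ)) MajLE (finsetNorm vecNorm) g n

/-- The length function of `(P_f(ℕ ^ d), min)`. -/
noncomputable def lengthMin (d : ℕ) (g : ℕ → ℕ) (n : ℕ) : ℕ :=
  lengthFn (A := Finset (Fin d → ℕ)) MinLE (finsetNorm vecNorm) g n

/-! Iterating the predecessor from `α` gives a strictly decreasing sequence of `g_α(n)` ordinals,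
the `i`-th of norm at most `g^i(n)`. An ordinal below `ω^(ω^(d-1))` has exponents below `ω^(d-1)`,
each given by its `d-1` coefficients. Adding the running sum of the coefficients as one more
coordinate turns every term into a point of `ℕ^d`, and the ordinal into a finite set. If `b < a`,
the set of `a` is not majorised by that of `b` (`exists_termVecs_not_le`). For an ordinal of norm
`N` there are at most `(N+1)^(d-1)` terms with coefficients at most `N`, so the set has norm at most
`φ(N)`.

For the second inequality, replace each set by the complement of its downward closure within a box:
a good pair for `min` among the complements is a good pair for `maj` among the sets
(`majLE_of_minLE_boxComplement`). The maxima exist since both orderings are well-quasi-orders and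
each norm bound leaves finitely many sets. -/

/-! ### Norms of predecessors and descending sequences -/

/-- `ordNorm o ≤ x`, except that the least term of `o`, or hereditarily the least term of the
exponent of its last term, may have coefficient `x + 1`. -/
def AlmostNormLE (x : ℕ) : ONote → Prop
  | ONote.zero => True
  | ONote.oadd e n a =>
    ((n : ℕ) ≤ x ∧ ordNorm e ≤ x ∧ AlmostNormLE x a) ∨
      (a = ONote.zero ∧ ordNorm e ≤ x ∧ (n : ℕ) ≤ x + 1) ∨
      (a = ONote.zero ∧ (n : ℕ) = 1 ∧ AlmostNormLE x e)

theorem almostNormLE_of_ordNorm_le {x : ℕ} {o : ONote} (h : ordNorm o ≤ x) :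
    AlmostNormLE x o := by
  induction o with
  | zero => trivial
  | oadd e n a _ iha =>
    simp only [ordNorm, max_le_iff] at h
    exact Or.inl ⟨h.1.1, h.1.2, iha h.2⟩

/-- The norm bounds inherited by `o.fundamentalSequence` from `AlmostNormLE x o`. -/
def FundamentalNormLE (x : ℕ) : Option ONote ⊕ (ℕ → ONote) → Prop
  | Sum.inl none => True
  | Sum.inl (some a) => ordNorm a ≤ x
  | Sum.inr f => AlmostNormLE x (f x)

/-- Passing to `λ(x)` may create a coefficient `x + 1`, but only at the very end of the normal form,
where the next step lowers it. The exceptional coefficient is gone once a successor is decremented.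
-/
theorem fundamentalNormLE_of_almostNormLE {x : ℕ} {o : ONote} (h : AlmostNormLE x o) :
    FundamentalNormLE x o.fundamentalSequence := by
  induction o with
  | zero => trivial
  | oadd e n a ihe iha =>
    have hn : n.natPred + 1 = (n : ℕ) := PNat.natPred_add_one n
    have hprop := ONote.fundamentalSequence_has_prop a
    rw [ONote.fundamentalSequence]
    rcases ha : a.fundamentalSequence with (⟨_ | a'⟩ | f)
    · rw [ha] at hprop
      replace hprop : a = ONote.zero := hprop
      subst hprop
      have h' : (ordNorm e ≤ x ∧ (n : ℕ) ≤ x + 1) ∨ ((n : ℕ) = 1 ∧ AlmostNormLE x e) := by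
        rcases h with h | h | h
        · exact Or.inl ⟨h.2.1, by omega⟩
        · exact Or.inl h.2
        · exact Or.inr h.2
      have he : AlmostNormLE x e := h'.elim (fun h => almostNormLE_of_ordNorm_le h.1) And.right
      replace ihe := ihe he
      have hep := ONote.fundamentalSequence_has_prop e
      rcases hf : e.fundamentalSequence with (⟨_ | e'⟩ | f) <;> rw [hf] at ihe hep <;>
        rcases hk : n.natPred with _ | k <;>
        simp only [FundamentalNormLE, AlmostNormLE, ordNorm, Nat.succPNat_coe, PNat.one_coe,
          true_and, and_true] at ihe ⊢
      · exact Nat.zero_le _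
      · simp only [max_le_iff]
        refine ⟨⟨?_, Nat.zero_le _⟩, Nat.zero_le _⟩
        rcases h' with h' | h' <;> omega
      · exact Or.inr (Or.inl ⟨ihe, le_rfl⟩)
      · rcases h' with h' | h'
        · exact Or.inl ⟨by omega, h'.1, Or.inr (Or.inl ⟨ihe, le_rfl⟩)⟩
        · omega
      · exact Or.inr (Or.inr ihe)
      · rcases h' with h' | h'
        · exact Or.inl ⟨by omega, h'.1, Or.inr (Or.inr ihe)⟩
        · omega
    all_goals
      have hne : a ≠ ONote.zero := by
        rintro rfl
        simp [ONote.fundamentalSequence] at ha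
      obtain ⟨h1, h2, h3⟩ : (n : ℕ) ≤ x ∧ ordNorm e ≤ x ∧ AlmostNormLE x a := by
        rcases h with h | h | h
        · exact h
        · exact absurd h.1 hne
        · exact absurd h.1 hne
      replace iha := iha h3
      rw [ha] at iha
    · simp only [FundamentalNormLE, ordNorm, max_le_iff] at iha ⊢
      exact ⟨⟨h1, h2⟩, iha⟩
    · exact Or.inl ⟨h1, h2, iha⟩

theorem ordPred_nf_and_ordNorm_le (x : ℕ) (o : ONote) (ho : o.NF) (hx : AlmostNormLE x o) :
    (ordPred x o).NF ∧ ordNorm (ordPred x o) ≤ x := by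
  induction o using (InvImage.wf ONote.repr Ordinal.lt_wf).induction with
  | h o ih =>
    have hN := fundamentalNormLE_of_almostNormLE hx
    rw [ordPred]
    split
    · exact ⟨ONote.NF.zero, Nat.zero_le _⟩
    · rename_i a h e _
      rw [e] at hN
      exact ⟨h.2 ho, hN⟩
    · rename_i f h e _
      rw [e] at hN
      exact ih (f x) (h.2.1 x).2.1 ((h.2.1 x).2.2 ho) hN

theorem exists_decreasing_seq_cichon {g : ℕ → ℕ} (hg : ∀ x, x ≤ g x) (o : ONote) (x : ℕ)
    (ho : o.NF) (hx : ordNorm o ≤ x) :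
    ∃ a : Fin (cichon g o x) → ONote,
      (∀ i, (a i).NF ∧ a i < o ∧ ordNorm (a i) ≤ g^[(i : ℕ)] x) ∧
        ∀ i j, i < j → a j < a i := by
  induction o using (InvImage.wf ONote.repr Ordinal.lt_wf).induction generalizing x with
  | h o ih =>
    by_cases h0 : o = 0
    · have hc : cichon g o x = 0 := by rw [cichon, dif_pos h0]
      rw [hc]
      exact ⟨Fin.elim0, fun i => i.elim0, fun i => i.elim0⟩
    · have hc : cichon g o x = cichon g (ordPred x o) (g x) + 1 := by
        rw [cichon, dif_neg h0, add_comm]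
      have hlt := ordPred_lt x o h0
      obtain ⟨h1, h2⟩ := ordPred_nf_and_ordNorm_le x o ho (almostNormLE_of_ordNorm_le hx)
      obtain ⟨a, ha, hd⟩ := ih _ hlt (g x) h1 (h2.trans (hg x))
      rw [hc]
      refine ⟨Fin.cons (ordPred x o) a, fun i => ?_, fun i j hij => ?_⟩
      · induction i using Fin.cases with
        | zero => exact ⟨h1, hlt, h2⟩
        | succ i => exact ⟨(ha i).1, (ha i).2.1.trans hlt, (ha i).2.2⟩
      · induction j using Fin.cases with
        | zero => exact absurd hij (Fin.not_lt_zero _)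
        | succ j =>
          induction i using Fin.cases with
          | zero => exact (ha j).2.1
          | succ i => exact hd i j (Fin.succ_lt_succ_iff.1 hij)

/-! ### Coding Cantor normal forms by finite sets of vectors -/

/-- The coefficient of `ω ^ j` in the Cantor normal form `e`. -/
noncomputable def omegaCoeff : ONote → ℕ → ℕ
  | ONote.zero, _ => 0
  | ONote.oadd f k b, j => if f.repr = j then (k : ℕ) else omegaCoeff b j

theorem omegaCoeff_le_ordNorm (e : ONote) (j : ℕ) : omegaCoeff e j ≤ ordNorm e := by
  induction e with
  | zero => exact le_rfl
  | oadd f k b _ ih =>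
    simp only [omegaCoeff, ordNorm]
    split
    · exact (le_max_left _ _).trans (le_max_left _ _)
    · exact ih.trans (le_max_right _ _)

theorem omegaCoeff_eq_zero_of_nfBelow {e : ONote} {b : Ordinal} {j : ℕ} (h : e.NFBelow b)
    (hb : b ≤ j) : omegaCoeff e j = 0 := by
  induction e generalizing b with
  | zero => rfl
  | oadd f k a _ ih =>
    have hf : f.repr < j := h.lt.trans_le hb
    rw [omegaCoeff, if_neg hf.ne]
    exact ih h.snd hf.le

/-- Ordinals below `ω^m` compare lexicographically by coefficients, so the larger one wins at the
first difference. -/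
theorem exists_omegaCoeff_lt {m : ℕ} {e e' : ONote} (he : e.NFBelow m) (he' : e'.NF)
    (h : e' < e) : ∃ j < m, omegaCoeff e' j < omegaCoeff e j := by
  induction e generalizing e' with
  | zero => exact absurd h (not_lt_of_ge (zero_le (a := e'.repr)))
  | oadd f k b _ ih =>
    obtain ⟨j, hj⟩ := Ordinal.lt_omega0.1 (he.lt.trans (Ordinal.natCast_lt_omega0 m))
    have hjm : j < m := by
      have := he.lt
      rw [hj] at this
      exact_mod_cast this
    have hk : omegaCoeff (ONote.oadd f k b) j = k := by rw [omegaCoeff, if_pos hj]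
    cases e' with
    | zero => exact ⟨j, hjm, by rw [hk]; exact k.pos⟩
    | oadd f' k' b' =>
      have := he.fst
      have := he'.fst
      have hcmp := ONote.cmp_compares f' f
      rcases lt_trichotomy f'.repr f.repr with hf | hf | hf
      · refine ⟨j, hjm, ?_⟩
        rw [hk, omegaCoeff_eq_zero_of_nfBelow (ONote.NF.below_of_lt hf he') hj.le]
        exact k.pos
      · obtain rfl := ONote.repr_inj.1 hf
        rcases lt_trichotomy (k' : ℕ) k with hkk | hkk | hkk
        · exact ⟨j, hjm, by rw [hk, omegaCoeff, if_pos hj]; exact hkk⟩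
        · obtain rfl := PNat.coe_inj.1 hkk
          have hb : b' < b := by
            simpa only [ONote.lt_def, ONote.repr, add_lt_add_iff_left] using h
          obtain ⟨i, him, hi⟩ := ih (he.snd.mono he.lt.le) he'.snd hb
          have hij : f'.repr ≠ i := by
            intro hfi
            rw [omegaCoeff_eq_zero_of_nfBelow he.snd hfi.le] at hi
            exact Nat.not_lt_zero _ hi
          exact ⟨i, him, by rwa [omegaCoeff, omegaCoeff, if_neg hij, if_neg hij]⟩
        · exact absurd h (not_lt_of_ge (ONote.oadd_lt_oadd_2 ⟨⟨_, he⟩⟩ hkk).le)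
      · exact absurd h (not_lt_of_ge (ONote.oadd_lt_oadd_1 ⟨⟨_, he⟩⟩ hf).le)

/-- The vector of the coefficients of `ω ^ 0, …, ω ^ (m - 1)`. -/
noncomputable def omegaCoeffVec (m : ℕ) (e : ONote) : Fin m → ℕ := fun j => omegaCoeff e j

/-- The coefficient vectors of the exponents of a Cantor normal form. -/
noncomputable def exponentVecs (m : ℕ) : ONote → Finset (Fin m → ℕ)
  | ONote.zero => ∅
  | ONote.oadd e _ a => insert (omegaCoeffVec m e) (exponentVecs m a)

/-- The points `(s + c, v)`, where `v` is the coefficient vector of an exponent of a Cantor normal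
form and `c` is the sum of the coefficients of the terms with at least that exponent. -/
noncomputable def termVecs (m : ℕ) : ℕ → ONote → Finset (Fin (m + 1) → ℕ)
  | _, ONote.zero => ∅
  | s, ONote.oadd e n a =>
    insert (Fin.cons (s + n) (omegaCoeffVec m e)) (termVecs m (s + n) a)

theorem lt_of_mem_termVecs {m s : ℕ} {o : ONote} {y : Fin (m + 1) → ℕ}
    (hy : y ∈ termVecs m s o) : s < y 0 := by
  induction o generalizing s with
  | zero => simp [termVecs] at hy
  | oadd e n a _ ih =>
    rw [termVecs, Finset.mem_insert] at hy
    rcases hy with rfl | hy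
    · have := n.pos
      simp
    · exact (Nat.le_add_right s n).trans_lt (ih hy)

theorem tail_mem_exponentVecs {m s : ℕ} {o : ONote} {y : Fin (m + 1) → ℕ}
    (hy : y ∈ termVecs m s o) : Fin.tail y ∈ exponentVecs m o := by
  induction o generalizing s with
  | zero => simp [termVecs] at hy
  | oadd e n a _ ih =>
    rw [termVecs, Finset.mem_insert] at hy
    rw [exponentVecs, Finset.mem_insert]
    rcases hy with rfl | hy
    · exact Or.inl (Fin.tail_cons _ _)
    · exact Or.inr (ih hy)

theorem exists_exponent_of_mem_exponentVecs {m : ℕ} {o : ONote} {b : Ordinal} (ho : o.NFBelow b)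
    {v : Fin m → ℕ} (hv : v ∈ exponentVecs m o) :
    ∃ e : ONote, e.NF ∧ e.repr < b ∧ ordNorm e ≤ ordNorm o ∧ v = omegaCoeffVec m e := by
  induction o generalizing b with
  | zero => simp [exponentVecs] at hv
  | oadd e n a _ ih =>
    rw [exponentVecs, Finset.mem_insert] at hv
    rcases hv with rfl | hv
    · exact ⟨e, ho.fst, ho.lt, (le_max_right _ _).trans (le_max_left _ _), rfl⟩
    · obtain ⟨e', h1, h2, h3, h4⟩ := ih (ho.snd.mono ho.lt.le) hv
      exact ⟨e', h1, h2, h3.trans (le_max_right _ _), h4⟩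

theorem not_omegaCoeffVec_le_of_mem_exponentVecs {m : ℕ} {e o : ONote} (he : e.NFBelow m)
    (ho : o.NFBelow e.repr) {v : Fin m → ℕ} (hv : v ∈ exponentVecs m o) :
    ¬ omegaCoeffVec m e ≤ v := by
  obtain ⟨e', h1, h2, -, rfl⟩ := exists_exponent_of_mem_exponentVecs ho hv
  obtain ⟨j, hj, hlt⟩ := exists_omegaCoeff_lt he h1 h2
  exact fun h => absurd (h ⟨j, hj⟩) (not_le_of_gt hlt)

theorem nfBelow_exponent {m : ℕ} {e a : ONote} {n : ℕ+}
    (h : (ONote.oadd e n a).NFBelow (Ordinal.omega0 ^ (m : Ordinal))) : e.NFBelow m :=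
  ONote.NF.below_of_lt' h.lt h.fst

theorem card_exponentVecs_oadd {m : ℕ} {e a : ONote} {n : ℕ+}
    (h : (ONote.oadd e n a).NFBelow (Ordinal.omega0 ^ (m : Ordinal))) :
    (exponentVecs m (ONote.oadd e n a)).card = (exponentVecs m a).card + 1 := by
  rw [exponentVecs, Finset.card_insert_of_notMem]
  exact fun hv => not_omegaCoeffVec_le_of_mem_exponentVecs (nfBelow_exponent h) h.snd hv le_rfl

theorem card_exponentVecs_le {m : ℕ} {o : ONote} {b : Ordinal} (ho : o.NFBelow b) :
    (exponentVecs m o).card ≤ (ordNorm o + 1) ^ m := by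
  have hsub : exponentVecs m o ⊆ Fintype.piFinset fun _ => Finset.range (ordNorm o + 1) := by
    intro v hv
    obtain ⟨e, -, -, he, rfl⟩ := exists_exponent_of_mem_exponentVecs ho hv
    rw [Fintype.mem_piFinset]
    exact fun j => Finset.mem_range_succ_iff.2 ((omegaCoeff_le_ordNorm e j).trans he)
  simpa using Finset.card_le_card hsub

theorem termVecs_zero_coord_le {m s N : ℕ} {o : ONote} {y : Fin (m + 1) → ℕ}
    (ho : o.NFBelow (Ordinal.omega0 ^ (m : Ordinal))) (hN : ordNorm o ≤ N)
    (hy : y ∈ termVecs m s o) : y 0 ≤ s + N * (exponentVecs m o).card := by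
  induction o generalizing s with
  | zero => simp [termVecs] at hy
  | oadd e n a _ ih =>
    rw [card_exponentVecs_oadd ho, mul_add_one]
    simp only [ordNorm, max_le_iff] at hN
    rw [termVecs, Finset.mem_insert] at hy
    rcases hy with rfl | hy
    · simp only [Fin.cons_zero]
      omega
    · have := ih (ho.snd.mono ho.lt.le) hN.2 hy
      omega

theorem card_termVecs_le {m s : ℕ} {o : ONote}
    (ho : o.NFBelow (Ordinal.omega0 ^ (m : Ordinal))) :
    (termVecs m s o).card ≤ (exponentVecs m o).card := by
  induction o generalizing s with
  | zero => simp [termVecs]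
  | oadd e n a _ ih =>
    rw [card_exponentVecs_oadd ho, termVecs]
    exact (Finset.card_insert_le _ _).trans
      (Nat.succ_le_succ (ih (ho.snd.mono ho.lt.le)))

theorem finsetNorm_vecNorm_le_iff {d N : ℕ} {X : Finset (Fin d → ℕ)} :
    finsetNorm vecNorm X ≤ N ↔ (∀ x ∈ X, ∀ k, x k ≤ N) ∧ X.card ≤ N := by
  simp [finsetNorm, vecNorm]

theorem finsetNorm_termVecs_le {m : ℕ} {o : ONote}
    (ho : o.NFBelow (Ordinal.omega0 ^ (m : Ordinal))) :
    finsetNorm vecNorm (termVecs m 0 o) ≤ ordNorm o * (ordNorm o + 1) ^ m := by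
  cases o with
  | zero => simp [termVecs, finsetNorm]
  | oadd e n a =>
    set o := ONote.oadd e n a with hodef
    have hpos : 1 ≤ ordNorm o :=
      Nat.succ_le_of_lt (n.pos.trans_le ((le_max_left _ _).trans (le_max_left _ _)))
    have hone : 1 ≤ (ordNorm o + 1) ^ m := Nat.one_le_pow _ _ (Nat.succ_pos _)
    have hcard := card_exponentVecs_le (m := m) ho
    refine finsetNorm_vecNorm_le_iff.2 ⟨fun x hx k => ?_, ?_⟩
    · induction k using Fin.cases with
      | zero =>
        have := termVecs_zero_coord_le ho le_rfl hx
        rw [zero_add] at this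
        exact this.trans (Nat.mul_le_mul_left _ hcard)
      | succ k =>
        obtain ⟨e', -, -, he', hv⟩ := exists_exponent_of_mem_exponentVecs ho
          (tail_mem_exponentVecs hx)
        have hk : x k.succ = omegaCoeff e' k := congrFun hv k
        rw [hk]
        exact ((omegaCoeff_le_ordNorm e' k).trans he').trans (Nat.le_mul_of_pos_right _ hone)
    · exact ((card_termVecs_le ho).trans hcard).trans (Nat.le_mul_of_pos_left _ hpos)

/-- The witness is the point of `a` at the first term where `a` and `b` differ. Points of the shared
initial terms have a smaller running sum; points of later terms have a smaller exponent, whose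
vector cannot dominate; a point with the same exponent has a smaller coefficient. -/
theorem exists_termVecs_not_le {m : ℕ} {a b : ONote}
    (ha : a.NFBelow (Ordinal.omega0 ^ (m : Ordinal))) (hb : b.NF) (hba : b < a) (s : ℕ) :
    ∃ x ∈ termVecs m s a, ∀ y ∈ termVecs m s b, ¬ x ≤ y := by
  induction a generalizing b s with
  | zero => exact absurd hba (not_lt_of_ge (zero_le (a := b.repr)))
  | oadd e n a _ ih =>
    have he := nfBelow_exponent ha
    have head_not_le : ∀ (t c : ℕ) (o : ONote), o.NFBelow e.repr → ∀ y ∈ termVecs m t o,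
        ¬ (Fin.cons c (omegaCoeffVec m e) : Fin (m + 1) → ℕ) ≤ y := by
      intro t c o ho y hy hle
      refine not_omegaCoeffVec_le_of_mem_exponentVecs he ho (tail_mem_exponentVecs hy) fun j => ?_
      exact hle j.succ
    cases b with
    | zero => exact ⟨_, Finset.mem_insert_self _ _, fun y hy => absurd hy (Finset.notMem_empty y)⟩
    | oadd e' n' b =>
      have := ha.fst
      have := hb.fst
      rcases lt_trichotomy e'.repr e.repr with hf | hf | hf
      · exact ⟨_, Finset.mem_insert_self _ _, head_not_le _ _ _ (ONote.NF.below_of_lt hf hb)⟩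
      · obtain rfl := ONote.repr_inj.1 hf
        rcases lt_trichotomy (n' : ℕ) n with hnn | hnn | hnn
        · refine ⟨_, Finset.mem_insert_self _ _, fun y hy => ?_⟩
          rw [termVecs, Finset.mem_insert] at hy
          rcases hy with rfl | hy
          · intro hle
            have := hle 0
            simp only [Fin.cons_zero] at this
            omega
          · exact head_not_le _ _ _ hb.snd' y hy
        · obtain rfl := PNat.coe_inj.1 hnn
          have hlt : b < a := by
            simpa only [ONote.lt_def, ONote.repr, add_lt_add_iff_left] using hba
          obtain ⟨x, hx, hxy⟩ := ih (ha.snd.mono ha.lt.le) hb.snd hlt (s + n')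
          refine ⟨x, Finset.mem_insert_of_mem hx, fun y hy => ?_⟩
          rw [termVecs, Finset.mem_insert] at hy
          rcases hy with rfl | hy
          · intro hle
            have := hle 0
            simp only [Fin.cons_zero] at this
            -- `x` lies beyond the shared leading term, so its running sum exceeds `s + n'`.
            exact absurd (lt_of_mem_termVecs hx) (not_lt_of_ge this)
          · exact hxy y hy
        · exact absurd hba (not_lt_of_ge (ONote.oadd_lt_oadd_2 ⟨⟨_, ha⟩⟩ hnn).le)
      · exact absurd hba (not_lt_of_ge (ONote.oadd_lt_oadd_1 ⟨⟨_, ha⟩⟩ hf).le)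

/-! ### Lower bound for the majoring ordering -/

theorem le_mul_succ_pow (d x : ℕ) : x ≤ x * (x + 1) ^ d :=
  Nat.le_mul_of_pos_right _ (Nat.pow_pos (Nat.succ_pos _))

theorem mul_succ_pow_mono (d : ℕ) : Monotone fun x : ℕ => x * (x + 1) ^ d :=
  fun _ _ h => Nat.mul_le_mul h (Nat.pow_le_pow_left (Nat.succ_le_succ h) d)

theorem apply_iterate_le_iterate_comp {g φ : ℕ → ℕ} (hg : Monotone g) (hφ : Monotone φ)
    (hφ' : ∀ x, x ≤ φ x) (n i : ℕ) : φ (g^[i] n) ≤ (φ ∘ g)^[i] (φ n) := by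
  induction i with
  | zero => exact le_rfl
  | succ i ih =>
    rw [Function.iterate_succ_apply', Function.iterate_succ_apply']
    exact hφ (hg ((hφ' _).trans ih))

theorem cichon_mem_badLengths_maj {m n : ℕ} {g φ : ℕ → ℕ} (hg : Monotone g) (hg' : ∀ x, x ≤ g x)
    (hφ : ∀ x, φ x = x * (x + 1) ^ (m + 1)) {o : ONote} (ho : o.NF)
    (hrepr : o.repr = Ordinal.omega0 ^ (Ordinal.omega0 ^ (m : Ordinal.{0})))
    (hn : ordNorm o ≤ n) :
    cichon g o n ∈
      badLengths (A := Finset (Fin (m + 1) → ℕ)) MajLE (finsetNorm vecNorm) (φ ∘ g) (φ n) := by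
  obtain ⟨a, ha, hd⟩ := exists_decreasing_seq_cichon hg' o n ho hn
  have hbelow : ∀ i, (a i).NFBelow (Ordinal.omega0 ^ (m : Ordinal)) := fun i =>
    ONote.NF.below_of_lt' (hrepr ▸ (ha i).2.1) (ha i).1
  obtain rfl : φ = fun x => x * (x + 1) ^ (m + 1) := funext hφ
  refine ⟨fun i => termVecs m 0 (a i), fun i j hij hle => ?_, fun i => ?_⟩
  · obtain ⟨x, hx, hxy⟩ := exists_termVecs_not_le (hbelow i) (ha j).1 (hd i j hij) 0
    obtain ⟨y, hy, hle⟩ := hle x hx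
    exact hxy y hy hle
  · calc finsetNorm vecNorm (termVecs m 0 (a i))
        ≤ ordNorm (a i) * (ordNorm (a i) + 1) ^ m := finsetNorm_termVecs_le (hbelow i)
      _ ≤ ordNorm (a i) * (ordNorm (a i) + 1) ^ (m + 1) :=
        Nat.mul_le_mul_left _ (Nat.pow_le_pow_right (Nat.succ_pos _) (Nat.le_succ m))
      _ ≤ g^[(i : ℕ)] n * (g^[(i : ℕ)] n + 1) ^ (m + 1) :=
        mul_succ_pow_mono (m + 1) (ha i).2.2
      _ ≤ _ := apply_iterate_le_iterate_comp hg (mul_succ_pow_mono (m + 1))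
        (le_mul_succ_pow (m + 1)) n i

/-! ### Existence of the maximum lengths -/

/-- König's lemma: controlled bad sequences form a finitely branching tree, so unbounded lengths
would give an infinite bad sequence. -/
theorem bddAbove_badLengths {A : Type*} {le : A → A → Prop} (hle : WellQuasiOrdered le)
    {nrm : A → ℕ} (hnrm : ∀ N, {a | nrm a ≤ N}.Finite) (g : ℕ → ℕ) (n : ℕ) :
    BddAbove (badLengths le nrm g n) := by
  by_contra hunb
  rw [not_bddAbove_iff] at hunb
  let S : ℕ → Type _ := fun l => {x : Fin l → A // IsBadSeq le x ∧ IsControlledSeq nrm g n x}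
  let π : ∀ {i j : ℕ}, i ≤ j → S j → S i := fun hij x =>
    ⟨fun k => x.1 (Fin.castLE hij k), fun k k' hk => x.2.1 _ _ hk, fun k => x.2.2 (Fin.castLE hij k)⟩
  have hfin : ∀ l, Finite (S l) := fun l =>
    (Set.Finite.subset (Set.Finite.pi' fun i : Fin l => hnrm (g^[(i : ℕ)] n))
      fun x hx i => hx.2 i).to_subtype
  have hne : ∀ l, Nonempty (S l) := fun l => by
    obtain ⟨l', ⟨x, hx⟩, hl⟩ := hunb l
    exact ⟨π hl.le ⟨x, hx⟩⟩
  obtain ⟨f, hf⟩ := exists_seq_forall_proj_of_forall_finite (α := S) π (fun _ _ => rfl)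
    (fun _ _ _ _ _ _ => rfl) (fun _ _ => Set.toFinite _)
  obtain ⟨i, j, hij, h⟩ := hle fun i => (f (i + 1)).1 (Fin.last i)
  refine (f (j + 1)).2.1 (Fin.castLE (by omega) (Fin.last i)) (Fin.last j) hij ?_
  rwa [← hf (show i + 1 ≤ j + 1 by omega)] at h

theorem isGreatest_lengthFn {A : Type*} {le : A → A → Prop} (hle : WellQuasiOrdered le)
    {nrm : A → ℕ} (hnrm : ∀ N, {a | nrm a ≤ N}.Finite) (g : ℕ → ℕ) (n : ℕ) :
    IsGreatest (badLengths le nrm g n) (lengthFn le nrm g n) := by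
  have hb := bddAbove_badLengths hle hnrm g n
  exact ⟨Nat.sSup_mem ⟨0, Fin.elim0, fun i => i.elim0, fun i => i.elim0⟩ hb,
    fun _ hl => le_csSup hb hl⟩

theorem finite_setOf_finsetNorm_le (d N : ℕ) :
    {X : Finset (Fin d → ℕ) | finsetNorm vecNorm X ≤ N}.Finite := by
  refine (Finset.finite_toSet
    (Fintype.piFinset fun _ : Fin d => Finset.range (N + 1)).powerset).subset fun X hX => ?_
  rw [Finset.mem_coe, Finset.mem_powerset]
  intro x hx
  rw [Fintype.mem_piFinset]
  exact fun k => Finset.mem_range_succ_iff.2 ((finsetNorm_vecNorm_le_iff.1 hX).1 x hx k)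

theorem exists_mem_of_sublistForall₂ {A B : Type*} {R : A → B → Prop} {l₁ : List A} {l₂ : List B}
    (h : List.SublistForall₂ R l₁ l₂) {x : A} (hx : x ∈ l₁) : ∃ y ∈ l₂, R x y := by
  induction h with
  | nil => simp at hx
  | cons hab _ ih =>
    rcases List.mem_cons.1 hx with rfl | hx
    · exact ⟨_, List.mem_cons_self, hab⟩
    · obtain ⟨y, hy, hxy⟩ := ih hx
      exact ⟨y, List.mem_cons_of_mem _ hy, hxy⟩
  | cons_right _ ih =>
    obtain ⟨y, hy, hxy⟩ := ih hx
    exact ⟨y, List.mem_cons_of_mem _ hy, hxy⟩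

/-- Higman's lemma applied to enumerations of the sets. -/
theorem wellQuasiOrdered_majLE {A : Type*} [Preorder A] [WellQuasiOrderedLE A] :
    WellQuasiOrdered (MajLE : Finset A → Finset A → Prop) := by
  intro f
  have h := Set.PartiallyWellOrderedOn.partiallyWellOrderedOn_sublistForall₂ (· ≤ ·)
    (Set.partiallyWellOrderedOn_of_wellQuasiOrdered (wellQuasiOrdered_le (α := A)) Set.univ)
  obtain ⟨i, j, hij, hsub⟩ := h.exists_lt (f := fun i => (f i).toList)
    (fun _ _ _ => Set.mem_univ _)
  refine ⟨i, j, hij, fun x hx => ?_⟩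
  obtain ⟨y, hy, hxy⟩ := exists_mem_of_sublistForall₂ hsub (Finset.mem_toList.2 hx)
  exact ⟨y, Finset.mem_toList.1 hy, hxy⟩

/-- For each choice of a coordinate of every element of `X`, the least values of `X` in the chosen
coordinates (`⊤` in a coordinate that is never chosen). -/
noncomputable def complementBounds {d : ℕ} (X : Finset (Fin d → ℕ)) : Finset (Fin d → ℕ∞) :=
  open Classical in
  Finset.univ.image fun (f : X → Fin d) (k : Fin d) =>
    (Finset.univ.filter fun x => f x = k).inf fun x => (((x : Fin d → ℕ) k : ℕ) : ℕ∞)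

/-- A vector avoids the upward closure of `X` exactly when each `x ∈ X` exceeds it in some
coordinate `f x`; each choice of `f` cuts out one open box. -/
theorem forall_not_le_iff_complementBounds {d : ℕ} {X : Finset (Fin d → ℕ)} {v : Fin d → ℕ} :
    (∀ x ∈ X, ¬ x ≤ v) ↔ ∃ w ∈ complementBounds X, ∀ k, (v k : ℕ∞) < w k := by
  classical
  simp only [complementBounds, Finset.mem_image, Finset.mem_univ, true_and, exists_exists_eq_and,
    Finset.lt_inf_iff (ENat.natCast_lt_top _), Finset.mem_filter, Nat.cast_lt]
  constructor
  · intro h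
    have h' : ∀ x : X, ∃ k, v k < (x : Fin d → ℕ) k := fun x => by
      simpa [Pi.le_def] using h x x.2
    choose f hf using h'
    exact ⟨f, fun k x hx => hx ▸ hf x⟩
  · rintro ⟨f, hf⟩ x hx hle
    exact absurd (hle _) (not_le_of_gt (hf (f ⟨x, hx⟩) ⟨x, hx⟩ rfl))

/-- Majoring of the box corners means inclusion of the complements of the upward closures, hence
reverse inclusion of the closures, which is `MinLE`. -/
theorem wellQuasiOrdered_minLE (d : ℕ) :
    WellQuasiOrdered (MinLE : Finset (Fin d → ℕ) → Finset (Fin d → ℕ) → Prop) := by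
  intro f
  obtain ⟨i, j, hij, h⟩ := wellQuasiOrdered_majLE fun i => complementBounds (f i)
  refine ⟨i, j, hij, fun y hy => ?_⟩
  by_contra! hno
  obtain ⟨w, hw, hlt⟩ := forall_not_le_iff_complementBounds.1 hno
  obtain ⟨w', hw', hle⟩ := h w hw
  exact forall_not_le_iff_complementBounds.2 ⟨w', hw', fun k => (hlt k).trans_le (hle k)⟩
    y hy le_rfl

/-! ### From the majoring to the minoring ordering -/

/-- The points of the box `[0, N + 1] ^ d` outside the downward closure of `X`. -/
noncomputable def boxComplement {d : ℕ} (N : ℕ) (X : Finset (Fin d → ℕ)) : Finset (Fin d → ℕ) :=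
  open Classical in
  (Fintype.piFinset fun _ => Finset.range (N + 2)).filter fun v => ∀ x ∈ X, ¬ v ≤ x

theorem mem_boxComplement {d N : ℕ} {X : Finset (Fin d → ℕ)} {v : Fin d → ℕ} :
    v ∈ boxComplement N X ↔ (∀ k, v k ≤ N + 1) ∧ ∀ x ∈ X, ¬ v ≤ x := by
  simp [boxComplement, Nat.lt_succ_iff]

/-- A point of `X` not below `Y` would lie in the complement for `Y`, hence above a point of the
complement for `X`. -/
theorem majLE_of_minLE_boxComplement {d M N : ℕ} {X Y : Finset (Fin d → ℕ)} (hMN : M ≤ N)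
    (hX : finsetNorm vecNorm X ≤ M) (h : MinLE (boxComplement M X) (boxComplement N Y)) :
    MajLE X Y := by
  intro x hx
  by_contra! hno
  have hmem : x ∈ boxComplement N Y := mem_boxComplement.2
    ⟨fun k => ((finsetNorm_vecNorm_le_iff.1 hX).1 x hx k).trans (hMN.trans (Nat.le_succ N)), hno⟩
  obtain ⟨v, hv, hvx⟩ := h x hmem
  exact (mem_boxComplement.1 hv).2 x hx hvx

theorem boxComplement_nonempty {d N : ℕ} (hd : 1 ≤ d) {X : Finset (Fin d → ℕ)}
    (hX : finsetNorm vecNorm X ≤ N) : (boxComplement N X).Nonempty := by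
  refine ⟨fun _ => N + 1, mem_boxComplement.2 ⟨fun _ => le_rfl, fun x hx hle => ?_⟩⟩
  have h1 := hle ⟨0, hd⟩
  have h2 := (finsetNorm_vecNorm_le_iff.1 hX).1 x hx ⟨0, hd⟩
  exact absurd (h1.trans h2) (Nat.not_succ_le_self N)

theorem finsetNorm_boxComplement_le {d N : ℕ} (hd : 1 ≤ d) (X : Finset (Fin d → ℕ)) :
    finsetNorm vecNorm (boxComplement N X) ≤ (N + 2) ^ d := by
  refine finsetNorm_vecNorm_le_iff.2 ⟨fun v hv k => ?_, ?_⟩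
  · exact (((mem_boxComplement.1 hv).1 k).trans (Nat.le_succ _)).trans
      (Nat.le_self_pow (by omega) _)
  · classical
    refine (Finset.card_le_card (Finset.filter_subset _ _)).trans ?_
    simp

/-- A complement may have about `(L + 2)^d` points, too many for the control at its own index.
Prepending `∅` delays it by one step, which supplies a further factor `φ`. Badness survives because
`∅` is min-below only `∅`, and the corner with all coordinates `N + 1` keeps every complement
nonempty. -/
theorem exists_mem_badLengths_min_of_maj {d n l : ℕ} (hd : 1 ≤ d) {g φ p : ℕ → ℕ}
    (hg : Monotone g) (hg' : ∀ x, x ≤ g x) (hφ : ∀ x, φ x = x * (x + 1) ^ d)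
    (hp : ∀ x, p x = d * (x + 1))
    (hl : l ∈ badLengths (A := Finset (Fin d → ℕ)) MajLE (finsetNorm vecNorm) (φ ∘ g) (φ n)) :
    l + 1 ∈ badLengths (A := Finset (Fin d → ℕ)) MinLE (finsetNorm vecNorm) (p ∘ φ ∘ g)
      (p (φ n)) := by
  obtain ⟨X, hbad, hctrl⟩ := hl
  have hφm : Monotone φ := by
    rw [show φ = fun x => x * (x + 1) ^ d from funext hφ]
    exact mul_succ_pow_mono d
  have hφ' : ∀ x, x ≤ φ x := fun x => (hφ x).symm ▸ le_mul_succ_pow d x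
  have hpm : Monotone p := fun x y h => by
    rw [hp, hp]
    exact Nat.mul_le_mul_left d (Nat.succ_le_succ h)
  have hp' : ∀ x, x + 1 ≤ p x := fun x => by
    rw [hp]
    exact Nat.le_mul_of_pos_left _ hd
  have hLm : Monotone fun i => (φ ∘ g)^[i] (φ n) :=
    fun i j hij => Function.monotone_iterate_of_id_le (fun x => (hg' x).trans (hφ' _)) hij (φ n)
  have hLR : ∀ i, p ((φ ∘ g)^[i] (φ n)) ≤ (p ∘ φ ∘ g)^[i] (p (φ n)) :=
    apply_iterate_le_iterate_comp (hφm.comp hg) hpm (fun x => (Nat.le_succ x).trans (hp' x)) (φ n)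
  refine ⟨Fin.cons ∅ fun i : Fin l => boxComplement ((φ ∘ g)^[(i : ℕ)] (φ n)) (X i), ?_, ?_⟩
  · intro i j hij hle
    induction j using Fin.cases with
    | zero => exact absurd hij (Fin.not_lt_zero _)
    | succ j =>
      induction i using Fin.cases with
      | zero =>
        obtain ⟨v, hv⟩ := boxComplement_nonempty hd (hctrl j)
        obtain ⟨x, hx, -⟩ := hle v hv
        exact absurd hx (Finset.notMem_empty x)
      | succ i =>
        have hij' : i < j := Fin.succ_lt_succ_iff.1 hij
        exact hbad i j hij'
          (majLE_of_minLE_boxComplement (hLm (Fin.le_def.1 hij'.le)) (hctrl i) hle)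
  · intro i
    induction i using Fin.cases with
    | zero => exact (Nat.zero_le _)
    | succ i =>
      rw [Fin.cons_succ, Fin.val_succ, Function.iterate_succ_apply']
      set L := (φ ∘ g)^[(i : ℕ)] (φ n)
      set R := (p ∘ φ ∘ g)^[(i : ℕ)] (p (φ n))
      have hR : L + 1 ≤ R := (hp' L).trans (hLR i)
      calc finsetNorm vecNorm (boxComplement L (X i)) ≤ (L + 2) ^ d :=
            finsetNorm_boxComplement_le hd _
        _ ≤ (R + 1) ^ d := Nat.pow_le_pow_left (by omega) d
        _ ≤ R * (R + 1) ^ d := Nat.le_mul_of_pos_left _ (by omega)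
        _ = φ R := (hφ R).symm
        _ ≤ φ (g R) := hφm (hg' R)
        _ ≤ p (φ (g R)) := (Nat.le_succ _).trans (hp' _)

theorem mainTheorem8 (d : ℕ) (hd : 1 ≤ d) (g : ℕ → ℕ) (hg : StrictMono g) (hg' : ∀ x, x ≤ g x)
    (φ p : ℕ → ℕ) (hφ : ∀ x, φ x = x * (x + 1) ^ d) (hp : ∀ x, p x = d * (x + 1))
    (α : NONote)
    (hα : α.repr = Ordinal.omega0 ^ (Ordinal.omega0 ^ ((d - 1 : ℕ) : Ordinal.{0})))
    (n : ℕ) (hn : ordNorm α.1 ≤ n) :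
    IsGreatest (badLengths (A := Finset (Fin d → ℕ)) MajLE (finsetNorm vecNorm) (φ ∘ g) (φ n))
        (lengthMaj d (φ ∘ g) (φ n)) ∧
      IsGreatest
        (badLengths (A := Finset (Fin d → ℕ)) MinLE (finsetNorm vecNorm) (p ∘ φ ∘ g) (p (φ n)))
        (lengthMin d (p ∘ φ ∘ g) (p (φ n))) ∧
      cichon g α.1 n ≤ lengthMaj d (φ ∘ g) (φ n) ∧
      lengthMaj d (φ ∘ g) (φ n) ≤ lengthMin d (p ∘ φ ∘ g) (p (φ n)) := by
  have hmaj : IsGreatest _ (lengthMaj d (φ ∘ g) (φ n)) :=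
    isGreatest_lengthFn wellQuasiOrdered_majLE (finite_setOf_finsetNorm_le d) _ _
  have hmin : IsGreatest _ (lengthMin d (p ∘ φ ∘ g) (p (φ n))) :=
    isGreatest_lengthFn (wellQuasiOrdered_minLE d) (finite_setOf_finsetNorm_le d) _ _
  refine ⟨hmaj, hmin, hmaj.2 ?_, ?_⟩
  · obtain ⟨m, rfl⟩ := Nat.exists_eq_add_of_le' hd
    exact cichon_mem_badLengths_maj hg.monotone hg' hφ α.2 hα hn
  · exact (Nat.le_succ _).trans
      (hmin.2 (exists_mem_badLengths_min_of_maj hd hg.monotone hg' hφ hp hmaj.1))
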